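/- Let $V$ be any set, whose elements are called variables. The (ground) terms and (ground) substitutions of the system $R$ over $V$ are defined by simultaneous induction, with $a\in V$: $$M,N ::= a \mid MN \mid \lambda a.M \mid \boldsymbol{\lambda} a.M \mid s\circ M,\qquad s,q ::= id \mid \pi_a \mid \langle s, N\diagdown a\rangle \mid s\circ q .$$ Here $\lambda$ is the unmarked and $\boldsymbol{\lambda}$ the marked lambda; terms are taken literally, not up to renaming. The rewrite rules of $R$ are the following, for all $a,b\in V$, all terms $M,N$ and all substitutions $s,q,r$ (the operation $\circ$ associates to the right, $s\circ MN$ means $s\circ(MN)$, and the body of a lambda extends as far to the right as possible): - (Abs1) $s\circ\lambda a.M\to\lambda a.\langle\pi_a\circ s,\,a\diagdown a\rangle\circ M$ - (Abs2) $s\circ\boldsymbol{\lambda} a.M\to\boldsymbol{\lambda} a.\langle\pi_a\circ s,\,a\diagdown a\rangle\circ M$ - (Abs3) $s\circ\lambda a.M\to\boldsymbol{\lambda} a.\langle\pi_a\circ s,\,a\diagdown a\rangle\circ M$ - (Abs4) $s\circ\boldsymbol{\lambda} a.M\to\lambda a.\langle\pi_a\circ s,\,a\diagdown a\rangle\circ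 M$ - (App) $s\circ MN\to(s\circ M)(s\circ N)$ - (ConsVar) $\langle s,N\diagdown a\rangle\circ a\to N$ - (New) $\langle s,N\diagdown a\rangle\circ b\to s\circ b$ if $a\ne b$ - (IdVar) $id\circ a\to a$ - (Clos) $s\circ q\circ M\to(s\circ q)\circ M$ - (Ass) $s\circ q\circ r\to(s\circ q)\circ r$ - (IdR) $s\circ id\to s$ - (IdShift) $id\circ\pi_a\to\pi_a$ - (ConsShift) $\langle s,N\diagdown a\rangle\circ\pi_a\to s$ - (Map) $s\circ\langle q,N\diagdown a\rangle\to\langle s\circ q,\,s\circ N\diagdown a\rangle$ - ($\pi_1$) $\pi_a\circ b\to b$ if $a\ne b$ - ($\pi_2$) $(s\circ\pi_a)\circ b\to s\circ b$ if $a\ne b$ - ($\alpha$) $\boldsymbol{\lambda} a.M\to\lambda b.\langle\pi_b,\,b\diagdown a\rangle\circ M$ - ($\xi$) $\boldsymbol{\lambda} a.M\to\lambda a.M$ One-step reduction is the closure of these rules under all term and substitution constructors: one rule is applied to one subterm or subsubstitution at an arbitrary position. **Theorem.** $R$ is strongly normalizing on the sets of ground terms and ground substitutions: there is no infinite reduction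 sequence $M_0\to M_1\to M_2\to\cdots$ of terms, and no infinite reduction sequence $s_0\to s_1\to s_2\to\cdots$ of substitutions. -/

import Mathlib

universe u

namespace LambdaPi

mutual
/-- Ground terms of the system `R` over a set `V` of variables:
`M, N ::= a | M N | λ a. M | 𝛌 a. M | s ∘ M`, where `𝛌` is the marked (bold) lambda. -/
inductive Term (V : Type u) where
  | var (a : V)
  | app (M N : Term V)
  | lam (a : V) (M : Term V)
  | mlam (a : V) (M : Term V)
  | clos (s : Subst V) (M : Term V)

/-- Ground substitutions of the system `R`:
`s, q ::= id | π_a | ⟨s, N ∖ a⟩ | s ∘ q`; here `cons s N a` is `⟨s, N ∖ a⟩`. -/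
inductive Subst (V : Type u) where
  | id
  | pi (a : V)
  | cons (s : Subst V) (N : Term V) (a : V)
  | comp (s q : Subst V)
end

/-- `lift s a` is the substitution `⟨π_a ∘ s, a ∖ a⟩`. -/
def lift {V : Type u} (s : Subst V) (a : V) : Subst V :=
  .cons (.comp (.pi a) s) (.var a) a

/-- The (ground instances of the) rules of `R` whose two sides are terms. -/
inductive TermRule {V : Type u} : Term V → Term V → Prop
  | abs1 (s : Subst V) (a : V) (M : Term V) :
      TermRule (.clos s (.lam a M)) (.lam a (.clos (lift s a) M))
  | abs2 (s : Subst V) (a : V) (M : Term V) :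
      TermRule (.clos s (.mlam a M)) (.mlam a (.clos (lift s a) M))
  | abs3 (s : Subst V) (a : V) (M : Term V) :
      TermRule (.clos s (.lam a M)) (.mlam a (.clos (lift s a) M))
  | abs4 (s : Subst V) (a : V) (M : Term V) :
      TermRule (.clos s (.mlam a M)) (.lam a (.clos (lift s a) M))
  | app (s : Subst V) (M N : Term V) :
      TermRule (.clos s (.app M N)) (.app (.clos s M) (.clos s N))
  | consVar (s : Subst V) (N : Term V) (a : V) :
      TermRule (.clos (.cons s N a) (.var a)) N
  | new (s : Subst V) (N : Term V) (a b : V) (h : a ≠ b) :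
      TermRule (.clos (.cons s N a) (.var b)) (.clos s (.var b))
  | idVar (a : V) : TermRule (.clos .id (.var a)) (.var a)
  | clos (s q : Subst V) (M : Term V) :
      TermRule (.clos s (.clos q M)) (.clos (.comp s q) M)
  | pi1 (a b : V) (h : a ≠ b) : TermRule (.clos (.pi a) (.var b)) (.var b)
  | pi2 (s : Subst V) (a b : V) (h : a ≠ b) :
      TermRule (.clos (.comp s (.pi a)) (.var b)) (.clos s (.var b))
  | alpha (a b : V) (M : Term V) :
      TermRule (.mlam a M) (.lam b (.clos (.cons (.pi b) (.var b) a) M))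
  | xi (a : V) (M : Term V) : TermRule (.mlam a M) (.lam a M)

/-- The (ground instances of the) rules of `R` whose two sides are substitutions. -/
inductive SubstRule {V : Type u} : Subst V → Subst V → Prop
  | ass (s q r : Subst V) :
      SubstRule (.comp s (.comp q r)) (.comp (.comp s q) r)
  | idR (s : Subst V) : SubstRule (.comp s .id) s
  | idShift (a : V) : SubstRule (.comp .id (.pi a)) (.pi a)
  | consShift (s : Subst V) (N : Term V) (a : V) :
      SubstRule (.comp (.cons s N a) (.pi a)) s
  | map (s q : Subst V) (N : Term V) (a : V) :
      SubstRule (.comp s (.cons q N a)) (.cons (.comp s q) (.clos s N) a)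

mutual
/-- One-step reduction of `R` on ground terms: one rule applied at one position. -/
inductive TermStep {V : Type u} : Term V → Term V → Prop
  | rule {M M' : Term V} : TermRule M M' → TermStep M M'
  | appL {M M' : Term V} (N : Term V) : TermStep M M' → TermStep (.app M N) (.app M' N)
  | appR (M : Term V) {N N' : Term V} : TermStep N N' → TermStep (.app M N) (.app M N')
  | lam (a : V) {M M' : Term V} : TermStep M M' → TermStep (.lam a M) (.lam a M')
  | mlam (a : V) {M M' : Term V} : TermStep M M' → TermStep (.mlam a M) (.mlam a M')
  | closL {s s' : Subst V} (M : Term V) : SubstStep s s' → TermStep (.clos s M) (.clos s' M)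
  | closR (s : Subst V) {M M' : Term V} : TermStep M M' → TermStep (.clos s M) (.clos s M')

/-- One-step reduction of `R` on ground substitutions: one rule applied at one position. -/
inductive SubstStep {V : Type u} : Subst V → Subst V → Prop
  | rule {s s' : Subst V} : SubstRule s s' → SubstStep s s'
  | consL {s s' : Subst V} (N : Term V) (a : V) :
      SubstStep s s' → SubstStep (.cons s N a) (.cons s' N a)
  | consR (s : Subst V) {N N' : Term V} (a : V) :
      TermStep N N' → SubstStep (.cons s N a) (.cons s N' a)
  | compL {s s' : Subst V} (q : Subst V) : SubstStep s s' → SubstStep (.comp s q) (.comp s' q)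
  | compR (s : Subst V) {q q' : Subst V} : SubstStep q q' → SubstStep (.comp s q) (.comp s q')
end

/-- A reduction relation is strongly normalizing if it admits no infinite reduction sequence
`x 0 → x 1 → x 2 → ⋯`. -/
def StronglyNormalizing {X : Type*} (r : X → X → Prop) : Prop :=
  ¬ ∃ x : ℕ → X, ∀ n : ℕ, r (x n) (x (n + 1))

end LambdaPi

/-!
The proof is semantic labelling followed by a lexicographic path order.

Forget all variable names and all distinctions that play no role in termination: variables, `id` and
`π_a` become one constant, application and `cons` become one pairing, and both uses of `∘` become one
binary operation. On the resulting `Skeleton`s the map `depth` (lambdas count one, `∘` adds, pairing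
takes the maximum) does not increase along any rule. Label every `∘` by its depth and every marked
lambda by the depth of its body. When a closure is pushed under a lambda by one of the `Abs` rules,
all labels created are strictly smaller than the label consumed, and `α` turns a marked lambda with
label `n` into a composition with label `n`. Hence the precedence
`∘₀ < 𝛌₀ < ∘₁ < 𝛌₁ < ⋯`, with the other symbols at the bottom, orients these rules and
`ξ`. The remaining rules project, distribute or reassociate `∘`; they do not increase labels and are
handled by the subterm property and by comparing the arguments of `∘` lexicographically, the right
one first.

`Skeleton.Below` collects the instances of this path order that are needed. Its well-foundedness,
`Skeleton.below_wellFounded`, says that each constructor preserves accessibility. The essential part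
is `Skeleton.acc_comp_mlam`, an induction on the label, then on the accessibility of the right
argument, then of the left one, and finally on the smaller skeleton. Every reduction step strictly
decreases the skeleton, by `TermStep.skel_lt` and `SubstStep.skel_lt`.
-/

namespace LambdaPi

/-! ### Skeletons and their path order -/

/-- Terms and substitutions with the variable names and the distinction of sorts erased: `atom`
stands for variables, `id` and `π_a`, `pair` for application and `cons`, and `comp` for both uses
of `∘`. -/
inductive Skeleton where
  | atom
  | pair (x y : Skeleton)
  | lam (x : Skeleton)
  | mlam (x : Skeleton)
  | comp (x y : Skeleton)

namespace Skeleton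

/-- A bound for the nesting of lambdas after all substitutions are carried out. The label of
`comp x y` is its depth `x.depth + y.depth`; the label of `mlam x` is `x.depth`. -/
def depth : Skeleton → ℕ
  | atom => 0
  | pair x y => max x.depth y.depth
  | lam x => x.depth + 1
  | mlam x => x.depth + 1
  | comp x y => x.depth + y.depth

/-- `Below u t` says that `u` is smaller than `t` in the path order. Only those clauses of the order
are included that reduction steps require; transitivity is not among them. -/
inductive Below : Skeleton → Skeleton → Prop
  | pair_congr_left {x x' : Skeleton} (y : Skeleton) :
      Below x' x → Below (pair x' y) (pair x y)
  | pair_congr_right (x : Skeleton) {y y' : Skeleton} :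
      Below y' y → Below (pair x y') (pair x y)
  | pair_left (x y : Skeleton) : Below x (pair x y)
  | pair_right (x y : Skeleton) : Below y (pair x y)
  | lam_congr {x x' : Skeleton} : Below x' x → Below (lam x') (lam x)
  | lam_arg (x : Skeleton) : Below x (lam x)
  | mlam_congr {x x' : Skeleton} :
      x'.depth ≤ x.depth → Below x' x → Below (mlam x') (mlam x)
  | mlam_arg (x : Skeleton) : Below x (mlam x)
  | atom_mlam (x : Skeleton) : Below atom (mlam x)
  | pair_mlam {u v x : Skeleton} :
      Below u (mlam x) → Below v (mlam x) → Below (pair u v) (mlam x)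
  | lam_mlam {u x : Skeleton} : Below u (mlam x) → Below (lam u) (mlam x)
  | comp_mlam {u v x : Skeleton} : u.depth + v.depth ≤ x.depth →
      Below u (mlam x) → Below v (mlam x) → Below (comp u v) (mlam x)
  | comp_left (x y : Skeleton) : Below x (comp x y)
  | comp_right (x y : Skeleton) : Below y (comp x y)
  | of_left {u x : Skeleton} (y : Skeleton) : Below u x → Below u (comp x y)
  | of_right {u y : Skeleton} (x : Skeleton) : Below u y → Below u (comp x y)
  | atom_comp (x y : Skeleton) : Below atom (comp x y)
  | pair_comp {u v x y : Skeleton} :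
      Below u (comp x y) → Below v (comp x y) → Below (pair u v) (comp x y)
  | lam_comp {u x y : Skeleton} : Below u (comp x y) → Below (lam u) (comp x y)
  | mlam_comp {u x y : Skeleton} : u.depth < x.depth + y.depth →
      Below u (comp x y) → Below (mlam u) (comp x y)
  | comp_label {u v x y : Skeleton} : u.depth + v.depth < x.depth + y.depth →
      Below u (comp x y) → Below v (comp x y) → Below (comp u v) (comp x y)
  | comp_lex_right {u v x y : Skeleton} : u.depth + v.depth ≤ x.depth + y.depth →
      Below u (comp x y) → Below v y → Below (comp u v) (comp x y)
  | comp_lex_left {u x y : Skeleton} : u.depth ≤ x.depth →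
      Below u x → Below (comp u y) (comp x y)

/-! ### Well-foundedness of the path order -/

theorem acc_atom : Acc Below atom :=
  ⟨_, fun _ h => nomatch h⟩

theorem acc_pair {x y : Skeleton} (hx : Acc Below x) (hy : Acc Below y) :
    Acc Below (pair x y) := by
  induction hx generalizing y with
  | intro x hx ihx =>
    induction hy with
    | intro y hy ihy =>
      refine ⟨_, fun u h => ?_⟩
      cases h with
      | pair_congr_left _ h => exact ihx _ h ⟨y, hy⟩
      | pair_congr_right _ h => exact ihy _ h
      | pair_left => exact ⟨x, hx⟩
      | pair_right => exact ⟨y, hy⟩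

theorem acc_lam {x : Skeleton} (hx : Acc Below x) : Acc Below (lam x) := by
  induction hx with
  | intro x hx ihx =>
    refine ⟨_, fun u h => ?_⟩
    cases h with
    | lam_congr h => exact ihx _ h
    | lam_arg => exact ⟨_, hx⟩

/-- Compositions and marked lambdas are treated together, because their labels interleave in the
precedence. -/
theorem acc_comp_mlam (n : ℕ) :
    (∀ y : Skeleton, Acc Below y → ∀ x : Skeleton, Acc Below x → x.depth + y.depth ≤ n →
      Acc Below (comp x y)) ∧
    (∀ x : Skeleton, Acc Below x → x.depth ≤ n → Acc Below (mlam x)) := by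
  induction n using Nat.strong_induction_on with
  | _ n ih =>
    have hcomp : ∀ y : Skeleton, Acc Below y → ∀ x : Skeleton, Acc Below x →
        x.depth + y.depth ≤ n → Acc Below (comp x y) := by
      intro y hy
      induction hy with
      | intro y hy ihy =>
        intro x hx
        induction hx with
        | intro x hx ihx =>
          intro hn
          refine ⟨_, fun u h => ?_⟩
          induction u with
          | atom => exact acc_atom
          | pair u v ihu ihv =>
            cases h with
            | comp_left => exact ⟨_, hx⟩
            | comp_right => exact ⟨_, hy⟩
            | of_left _ h => exact hx _ h
            | of_right _ h => exact hy _ h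
            | pair_comp h₁ h₂ => exact acc_pair (ihu h₁) (ihv h₂)
          | lam u ihu =>
            cases h with
            | comp_left => exact ⟨_, hx⟩
            | comp_right => exact ⟨_, hy⟩
            | of_left _ h => exact hx _ h
            | of_right _ h => exact hy _ h
            | lam_comp h => exact acc_lam (ihu h)
          | mlam u ihu =>
            cases h with
            | comp_left => exact ⟨_, hx⟩
            | comp_right => exact ⟨_, hy⟩
            | of_left _ h => exact hx _ h
            | of_right _ h => exact hy _ h
            | mlam_comp hd h => exact (ih _ (hd.trans_le hn)).2 u (ihu h) le_rfl
          | comp u v ihu ihv =>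
            cases h with
            | comp_left => exact ⟨_, hx⟩
            | comp_right => exact ⟨_, hy⟩
            | of_left _ h => exact hx _ h
            | of_right _ h => exact hy _ h
            | comp_label hd h₁ h₂ =>
              exact (ih _ (hd.trans_le hn)).1 v (ihv h₂) u (ihu h₁) le_rfl
            | comp_lex_right hd h₁ h₂ => exact ihy v h₂ u (ihu h₁) (hd.trans hn)
            | comp_lex_left hd h => exact ihx u h (by omega)
    refine ⟨hcomp, fun x hx => ?_⟩
    induction hx with
    | intro x hx ihx =>
      intro hn
      refine ⟨_, fun u h => ?_⟩
      induction u with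
      | atom => exact acc_atom
      | pair u v ihu ihv =>
        cases h with
        | mlam_arg => exact ⟨_, hx⟩
        | pair_mlam h₁ h₂ => exact acc_pair (ihu h₁) (ihv h₂)
      | lam u ihu =>
        cases h with
        | mlam_arg => exact ⟨_, hx⟩
        | lam_mlam h => exact acc_lam (ihu h)
      | mlam u ihu =>
        cases h with
        | mlam_arg => exact ⟨_, hx⟩
        | mlam_congr hd h => exact ihx u h (hd.trans hn)
      | comp u v ihu ihv =>
        cases h with
        | mlam_arg => exact ⟨_, hx⟩
        | comp_mlam hd h₁ h₂ => exact hcomp v (ihv h₂) u (ihu h₁) (hd.trans hn)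

theorem below_wellFounded : WellFounded Below := by
  refine ⟨fun t => ?_⟩
  induction t with
  | atom => exact acc_atom
  | pair x y hx hy => exact acc_pair hx hy
  | lam x hx => exact acc_lam hx
  | mlam x hx => exact (acc_comp_mlam _).2 x hx le_rfl
  | comp x y hx hy => exact (acc_comp_mlam _).1 y hy x hx le_rfl

/-! ### Instances of the path order for the rules -/

/-- The composite of the skeletons of `lift s a` and `M` lies below that of `s` and `λ a. M`; both
kinds of lambda are covered by `z`. -/
theorem below_comp_lift {x y z : Skeleton} (hz : z.depth = y.depth + 1)
    (hy : Below y z) :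
    Below (comp (pair (comp atom x) atom) y) (comp x z) := by
  refine .comp_label ?_ (.pair_comp ?_ (.atom_comp _ _)) (.of_right _ hy)
  · simp only [depth]
    omega
  · refine .comp_label ?_ (.atom_comp _ _) (.comp_left _ _)
    simp only [depth]
    omega

theorem below_mlam_comp_lift {x y z : Skeleton} (hz : z.depth = y.depth + 1)
    (hy : Below y z) :
    Below (mlam (comp (pair (comp atom x) atom) y)) (comp x z) := by
  refine .mlam_comp ?_ (below_comp_lift hz hy)
  simp only [depth]
  omega

/-- Reassociation, the common form of `Clos` and `Ass`. -/
theorem below_comp_assoc (x y z : Skeleton) :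
    Below (comp (comp x y) z) (comp x (comp y z)) := by
  refine .comp_lex_right ?_ (.comp_lex_right ?_ (.comp_left _ _) (.comp_left _ _))
    (.comp_right _ _)
  · simp only [depth]
    omega
  · simp only [depth]
    omega

/-- Distribution, the common form of `App` and `Map`. -/
theorem below_comp_distrib (x y z : Skeleton) :
    Below (pair (comp x y) (comp x z)) (comp x (pair y z)) := by
  refine .pair_comp (.comp_lex_right ?_ (.comp_left _ _) (.pair_left _ _))
    (.comp_lex_right ?_ (.comp_left _ _) (.pair_right _ _))
  · simp only [depth]
    omega
  · simp only [depth]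
    omega

/-- The strict decrease that the induction over reduction steps carries along: the depth is part of
it because the labels in the context of a step depend on the depth of the contracted part. -/
def Lt (u t : Skeleton) : Prop := u.depth ≤ t.depth ∧ Below u t

namespace Lt

variable {u t : Skeleton}

theorem pair_left (h : Lt u t) (y : Skeleton) : Lt (pair u y) (pair t y) :=
  ⟨max_le_max_right _ h.1, .pair_congr_left _ h.2⟩

theorem pair_right (x : Skeleton) (h : Lt u t) : Lt (pair x u) (pair x t) :=
  ⟨max_le_max_left _ h.1, .pair_congr_right _ h.2⟩

theorem lam (h : Lt u t) : Lt (lam u) (lam t) :=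
  ⟨Nat.add_le_add_right h.1 1, .lam_congr h.2⟩

theorem mlam (h : Lt u t) : Lt (mlam u) (mlam t) :=
  ⟨Nat.add_le_add_right h.1 1, .mlam_congr h.1 h.2⟩

theorem comp_left (h : Lt u t) (y : Skeleton) : Lt (comp u y) (comp t y) :=
  ⟨Nat.add_le_add_right h.1 _, .comp_lex_left h.1 h.2⟩

theorem comp_right (x : Skeleton) (h : Lt u t) : Lt (comp x u) (comp x t) :=
  ⟨Nat.add_le_add_left h.1 _,
    .comp_lex_right (Nat.add_le_add_left h.1 _) (.comp_left _ _) h.2⟩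

end Lt

theorem lt_wellFounded : WellFounded Lt :=
  Subrelation.wf (fun h => h.2) below_wellFounded

end Skeleton

/-! ### Reduction steps decrease the skeleton -/

variable {V : Type u}

mutual
/-- The skeleton of a term. -/
def Term.skel : Term V → Skeleton
  | .var _ => .atom
  | .app M N => .pair M.skel N.skel
  | .lam _ M => .lam M.skel
  | .mlam _ M => .mlam M.skel
  | .clos s M => .comp s.skel M.skel

/-- The skeleton of a substitution. -/
def Subst.skel : Subst V → Skeleton
  | .id => .atom
  | .pi _ => .atom
  | .cons s N _ => .pair s.skel N.skel
  | .comp s q => .comp s.skel q.skel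
end

open Skeleton

theorem TermRule.depth_le {M M' : Term V} (h : TermRule M M') :
    M'.skel.depth ≤ M.skel.depth := by
  cases h <;> simp only [lift, Term.skel, Subst.skel, depth] <;> omega

theorem TermRule.below {M M' : Term V} (h : TermRule M M') : Below M'.skel M.skel := by
  cases h with
  | abs1 s a M => exact .lam_comp (below_comp_lift rfl (.lam_arg _))
  | abs2 s a M => exact below_mlam_comp_lift rfl (.mlam_arg _)
  | abs3 s a M => exact below_mlam_comp_lift rfl (.lam_arg _)
  | abs4 s a M => exact .lam_comp (below_comp_lift rfl (.mlam_arg _))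
  | app s M N => exact below_comp_distrib _ _ _
  | consVar s N a => exact .of_left _ (.pair_right _ _)
  | new s N a b h => exact .comp_lex_left (le_max_left _ _) (.pair_left _ _)
  | idVar a => exact .atom_comp _ _
  | clos s q M => exact below_comp_assoc _ _ _
  | pi1 a b h => exact .atom_comp _ _
  | pi2 s a b h => exact .comp_lex_left (Nat.le_add_right _ _) (.comp_left _ _)
  | alpha a b M =>
    refine .lam_mlam (.comp_mlam ?_ (.pair_mlam (.atom_mlam _) (.atom_mlam _)) (.mlam_arg _))
    simp [Term.skel, Subst.skel, depth]
  | xi a M => exact .lam_mlam (.mlam_arg _)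

theorem SubstRule.depth_le {s s' : Subst V} (h : SubstRule s s') :
    s'.skel.depth ≤ s.skel.depth := by
  cases h <;> simp only [Subst.skel, Term.skel, depth] <;> omega

theorem SubstRule.below {s s' : Subst V} (h : SubstRule s s') : Below s'.skel s.skel := by
  cases h with
  | ass s q r => exact below_comp_assoc _ _ _
  | idR s => exact .comp_left _ _
  | idShift a => exact .atom_comp _ _
  | consShift s N a => exact .of_left _ (.pair_left _ _)
  | map s q N a => exact below_comp_distrib _ _ _

mutual
theorem TermStep.skel_lt {M M' : Term V} : TermStep M M' → Lt M'.skel M.skel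
  | .rule h => ⟨h.depth_le, h.below⟩
  | .appL _ h => h.skel_lt.pair_left _
  | .appR _ h => h.skel_lt.pair_right _
  | .lam _ h => h.skel_lt.lam
  | .mlam _ h => h.skel_lt.mlam
  | .closL _ h => h.skel_lt.comp_left _
  | .closR _ h => h.skel_lt.comp_right _

theorem SubstStep.skel_lt {s s' : Subst V} : SubstStep s s' → Lt s'.skel s.skel
  | .rule h => ⟨h.depth_le, h.below⟩
  | .consL _ _ h => h.skel_lt.pair_left _
  | .consR _ _ h => h.skel_lt.pair_right _
  | .compL _ h => h.skel_lt.comp_left _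
  | .compR _ h => h.skel_lt.comp_right _
end

theorem stronglyNormalizing_of_wellFounded {X Y : Type*} {r : X → X → Prop} {lt : Y → Y → Prop}
    (hlt : WellFounded lt) (f : X → Y) (h : ∀ x y, r x y → lt (f y) (f x)) :
    StronglyNormalizing r := by
  rintro ⟨x, hx⟩
  have : IsWellFounded Y lt := ⟨hlt⟩
  exact WellFounded.not_rel_apply_succ (r := lt) (fun n => f (x n))
    |>.elim fun n hn => hn (h _ _ (hx n))

end LambdaPi

theorem mainTheorem11 (V : Type u) :
    LambdaPi.StronglyNormalizing (LambdaPi.TermStep (V := V)) ∧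
      LambdaPi.StronglyNormalizing (LambdaPi.SubstStep (V := V)) :=
  ⟨LambdaPi.stronglyNormalizing_of_wellFounded LambdaPi.Skeleton.lt_wellFounded
      LambdaPi.Term.skel fun _ _ h => h.skel_lt,
    LambdaPi.stronglyNormalizing_of_wellFounded LambdaPi.Skeleton.lt_wellFounded
      LambdaPi.Subst.skel fun _ _ h => h.skel_lt⟩
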